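/- Let $H\subset\mathbb{R}^2$ be a regular hexagon (filled; normalized, without loss of generality up to similarity, to have circumradius $1$). The \emph{doubled regular $6$-gon} $D$ is the metric space obtained by gluing two copies of $H$ along their common boundary: points of the same copy have their Euclidean distance, and points $x,y$ of different copies have distance $\min_{p\in\partial H}(|x-p|+|p-y|)$. It is a topological $2$-sphere, flat away from the six cone points, which are the vertices of $H$. A \emph{geodesic net} in $D$ is a finite graph embedded in the complement of the cone points such that each edge is a geodesic (a locally shortest path) and such that at each vertex the unit tangent vectors to the edges (pointing into the edges, a loop contributing two of them) sum to zero. A \emph{figure-eight graph} is a geodesic net modeled on the graph with exactly one vertex and two loops. **Proposition.** The doubled regular $6$-gon admits a figure-eight graph. More precisely, there is a figure-eight graph on it in which the exterior turning angle of each of the two loops at the vertex, i.e. the angle between the velocity with which the loop arrives at the vertex and the velocity with which it leaves it, equals $2\pi/3$. -/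

import Mathlib

open Set Metric

/-! ### Doubled polygons -/

/-- The `k`-th vertex of the regular `n`-gon of circumradius `1` centred at `0`. -/
noncomputable def polygonVertex (n : ℕ) (k : Fin n) : ℂ :=
  Complex.exp (2 * Real.pi * Complex.I * ((k : ℕ) : ℂ) / (n : ℂ))

/-- The regular `n`-gon (as a filled convex region) of circumradius `1` centred at `0`. -/
def regularPolygon (n : ℕ) : Set ℂ :=
  convexHull ℝ (range (polygonVertex n))

/-- The boundary of a planar region, as a subset of the region. -/
def planarBoundary (P : Set ℂ) : Set P := {x | (x : ℂ) ∈ frontier P}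

theorem planarBoundary_inclusion_isometry (P : Set ℂ) :
    Isometry (Subtype.val : planarBoundary P → P) :=
  isometry_subtype_coe

theorem polygonVertex_mem (n : ℕ) (k : Fin n) : polygonVertex n k ∈ regularPolygon n :=
  subset_convexHull ℝ _ (mem_range_self k)

theorem regularPolygon_isCompact (n : ℕ) : IsCompact (regularPolygon n) :=
  (finite_range (polygonVertex n)).isCompact_convexHull ℝ

instance planarBoundary_regularPolygon_nonempty (n : ℕ) [NeZero n] :
    Nonempty (planarBoundary (regularPolygon n)) := by
  have hne : (regularPolygon n).Nonempty := ⟨_, polygonVertex_mem n 0⟩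
  have hU : regularPolygon n ≠ univ := (regularPolygon_isCompact n).ne_univ
  obtain ⟨z, hz⟩ := nonempty_frontier_iff.2 ⟨hne, hU⟩
  exact ⟨⟨⟨z, (regularPolygon_isCompact n).isClosed.frontier_subset hz⟩, hz⟩⟩

/-- The doubled regular `n`-gon: the metric space obtained by gluing two copies of the regular
`n`-gon along their common boundary. Points of the same copy are at their Euclidean distance;
points `x`, `y` of different copies are at distance `inf (|x - p| + |p - y|)`, where `p` runs
over the boundary. -/
abbrev DoubledPolygon (n : ℕ) [NeZero n] : Type :=
  GlueSpace (planarBoundary_inclusion_isometry (regularPolygon n))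
    (planarBoundary_inclusion_isometry (regularPolygon n))

/-- The first copy of the polygon in the doubled polygon. -/
noncomputable def frontSheet (n : ℕ) [NeZero n] : regularPolygon n → DoubledPolygon n :=
  toGlueL (planarBoundary_inclusion_isometry (regularPolygon n))
    (planarBoundary_inclusion_isometry (regularPolygon n))

/-- The cone points of the doubled polygon: the (identified) vertices of the two copies. The
doubled polygon is a flat surface away from these points. -/
def conePoints (n : ℕ) [NeZero n] : Set (DoubledPolygon n) :=
  range fun k : Fin n => frontSheet n ⟨polygonVertex n k, polygonVertex_mem n k⟩

/-! ### Geodesic nets on flat surfaces with singular points -/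

/-- A finite multigraph (loops and multiple edges allowed), each edge being given with an
arbitrary orientation. -/
structure OrientedMultigraph (V E : Type*) where
  src : E → V
  tgt : E → V

/-- The figure-eight: one vertex, two loops. -/
def figureEight : OrientedMultigraph Unit (Fin 2) where
  src _ := ()
  tgt _ := ()

/-- A Euclidean chart of `X` around `p`: an isometry from a ball around `p` onto a disc in the
Euclidean plane. -/
structure FlatChart (X : Type*) [MetricSpace X] (p : X) where
  toFun : X → ℂ
  radius : ℝ
  radius_pos : 0 < radius
  isometric : ∀ x ∈ ball p radius, ∀ y ∈ ball p radius, dist (toFun x) (toFun y) = dist x y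
  image_ball : toFun '' ball p radius = ball (toFun p) radius

/-- `γ`, restricted to `[0, L]`, is a unit speed geodesic, i.e. a locally shortest path
parametrized by arc length. -/
def IsUnitSpeedGeodesic {X : Type*} [MetricSpace X] (γ : ℝ → X) (L : ℝ) : Prop :=
  ∀ t ∈ Icc 0 L, ∃ ε > 0, ∀ s ∈ Icc 0 L ∩ ball t ε, ∀ s' ∈ Icc 0 L ∩ ball t ε,
    dist (γ s) (γ s') = |s - s'|

/-- A geodesic net modeled on the multigraph `G` in a surface `X` with set `S` of singular points:
an embedding of `G` into `X \ S` such that each edge is a geodesic and at each vertex the unit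
tangent vectors to the edges sum to zero. Only the values of `edge e` on `[0, length e]` matter. -/
structure GeodesicNet {V E : Type*} [DecidableEq V] [Fintype E] (G : OrientedMultigraph V E)
    (X : Type*) [MetricSpace X] (S : Set X) where
  vertex : V → X
  length : E → ℝ
  edge : E → ℝ → X
  length_pos : ∀ e, 0 < length e
  edge_zero : ∀ e, edge e 0 = vertex (G.src e)
  edge_length : ∀ e, edge e (length e) = vertex (G.tgt e)
  vertex_regular : ∀ v, vertex v ∉ S
  edge_regular : ∀ e, ∀ t ∈ Icc 0 (length e), edge e t ∉ S
  vertex_injective : Function.Injective vertex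
  edge_ne_vertex : ∀ e, ∀ t ∈ Ioo 0 (length e), ∀ v, edge e t ≠ vertex v
  edge_injective : ∀ e, ∀ t ∈ Ioo 0 (length e), ∀ e', ∀ t' ∈ Ioo 0 (length e'),
    edge e t = edge e' t' → e = e' ∧ t = t'
  edge_geodesic : ∀ e, IsUnitSpeedGeodesic (edge e) (length e)
  /-- A Euclidean chart around each vertex, in which the tangent vectors are read off. -/
  chart : ∀ v, FlatChart X (vertex v)
  /-- The unit tangent vector to `e` at its initial vertex, pointing into `e`. -/
  startDir : E → ℂ
  /-- The unit tangent vector to `e` at its final vertex, pointing into `e`. -/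
  endDir : E → ℂ
  hasDeriv_start : ∀ e, HasDerivWithinAt (fun t => (chart (G.src e)).toFun (edge e t))
    (startDir e) (Ici 0) 0
  hasDeriv_end : ∀ e, HasDerivWithinAt (fun t => (chart (G.tgt e)).toFun (edge e (length e - t)))
    (endDir e) (Ici 0) 0
  balanced : ∀ v, ∑ e, ((if G.src e = v then startDir e else 0) +
    (if G.tgt e = v then endDir e else 0)) = 0

/-- The exterior turning angle of a loop `e` of a geodesic net at its vertex: the angle between
the velocity with which `e` arrives at the vertex and the velocity with which it leaves it. (For a
loop, both vectors live in the same chart.) -/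
noncomputable def GeodesicNet.turningAngle {V E : Type*} [DecidableEq V] [Fintype E]
    {G : OrientedMultigraph V E} {X : Type*} [MetricSpace X] {S : Set X}
    (N : GeodesicNet G X S) (e : E) : ℝ :=
  InnerProductGeometry.angle (-(N.endDir e)) (N.startDir e)

/-! ### Sheets of a doubled polygon -/

/-! A geodesic of the doubled hexagon that avoids the cone points is a billiard trajectory of the
hexagon which changes sheet at each bounce. The figure-eight comes from one closed trajectory with
six bounces, hence three chords on each sheet. The three back chords are disjoint. Among the front
chords only two meet, at the point `(36, 6)` in the coordinates of `hexPoint`. Cutting the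
trajectory there gives two loops. Since the trajectory goes straight through the crossing, each loop
leaves with the velocity with which the other arrives, so the four tangent vectors cancel in pairs.
The chords cross at angle `2π/3`, which is the turning angle of both loops.

Two facts about the gluing carry the argument. `dist_sheet_of_reflection` says that a bounce obeying
the law of reflection is locally shortest. `eq_and_eq_of_sheet_hexPoint_eq` says that two points
coincide only if their planar positions do and they lie in the same sheet or on a side. The
coordinates make the sides and the bounce points integral, and every velocity `(u, v)` satisfies `u
^ 2 + 3 * v ^ 2 = 7`. Thus containment, embeddedness and the reflection law become linear arithmetic
on explicit segments. -/

theorem regularPolygon_frontier_subset {n : ℕ} : frontier (regularPolygon n) ⊆ regularPolygon n :=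
  (regularPolygon_isCompact n).isClosed.frontier_subset

section Sheets

variable {n : ℕ} [NeZero n]

/-- The second copy of the polygon in the doubled polygon. -/
noncomputable def backSheet (n : ℕ) [NeZero n] : regularPolygon n → DoubledPolygon n :=
  toGlueR (planarBoundary_inclusion_isometry (regularPolygon n))
    (planarBoundary_inclusion_isometry (regularPolygon n))

open Classical in
/-- The sheet `b` of the doubled polygon (`true` for the front), as a function on the plane whose
values outside of the polygon are meaningless. -/
noncomputable def sheet (n : ℕ) [NeZero n] (b : Bool) (z : ℂ) : DoubledPolygon n :=
  if hz : z ∈ regularPolygon n then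
    (if b then frontSheet n ⟨z, hz⟩ else backSheet n ⟨z, hz⟩)
  else frontSheet n ⟨polygonVertex n 0, polygonVertex_mem n 0⟩

theorem sheet_true {z : ℂ} (hz : z ∈ regularPolygon n) :
    sheet n true z = frontSheet n ⟨z, hz⟩ := by simp [sheet, hz]

theorem sheet_false {z : ℂ} (hz : z ∈ regularPolygon n) :
    sheet n false z = backSheet n ⟨z, hz⟩ := by simp [sheet, hz]

theorem dist_sheet {z w : ℂ} (b : Bool) (hz : z ∈ regularPolygon n) (hw : w ∈ regularPolygon n) :
    dist (sheet n b z) (sheet n b w) = dist z w := by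
  cases b
  · rw [sheet_false hz, sheet_false hw]
    exact (toGlueR_isometry _ _).dist_eq _ _
  · rw [sheet_true hz, sheet_true hw]
    exact (toGlueL_isometry _ _).dist_eq _ _

theorem sheet_eq_of_mem_frontier {z : ℂ} (hz : z ∈ frontier (regularPolygon n)) (b b' : Bool) :
    sheet n b z = sheet n b' z := by
  have key : sheet n true z = sheet n false z := by
    have hz' := regularPolygon_frontier_subset hz
    rw [sheet_true hz', sheet_false hz']
    exact congrFun (toGlue_commute (planarBoundary_inclusion_isometry (regularPolygon n))
      (planarBoundary_inclusion_isometry (regularPolygon n))) ⟨⟨z, hz'⟩, hz⟩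
  cases b <;> cases b' <;> simp [key]

theorem dist_front_back {z w : ℂ} (hz : z ∈ regularPolygon n) (hw : w ∈ regularPolygon n) :
    dist (sheet n true z) (sheet n false w) =
      ⨅ p : planarBoundary (regularPolygon n), (dist z (p : ℂ) + dist w (p : ℂ)) := by
  rw [sheet_true hz, sheet_false hw]
  -- The glued distance across sheets is the infimum plus a parameter `ε`, which is `0` for
  -- `GlueSpace`.
  exact add_zero _

theorem le_dist_sheet_not {z w : ℂ} {r : ℝ} (b : Bool) (hz : z ∈ regularPolygon n)
    (hw : w ∈ regularPolygon n)
    (h : ∀ p ∈ frontier (regularPolygon n), r ≤ dist z p + dist w p) :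
    r ≤ dist (sheet n b z) (sheet n (!b) w) := by
  cases b
  · rw [dist_comm, Bool.not_false, dist_front_back hw hz]
    exact le_ciInf fun p => by rw [add_comm]; exact h _ p.2
  · rw [Bool.not_true, dist_front_back hz hw]
    exact le_ciInf fun p => h _ p.2

theorem exists_eq_sheet (x : DoubledPolygon n) :
    ∃ b, ∃ z ∈ regularPolygon n, x = sheet n b z := by
  obtain ⟨y, rfl⟩ := Quotient.exists_rep x
  rcases y with z | z
  · exact ⟨true, z, z.2, (sheet_true z.2).symm⟩
  · exact ⟨false, z, z.2, (sheet_false z.2).symm⟩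

/-- Folding the two sheets onto the polygon does not increase distances. Hence every point has a
well-defined planar position. -/
theorem dist_le_dist_sheet {z w : ℂ} (b b' : Bool) (hz : z ∈ regularPolygon n)
    (hw : w ∈ regularPolygon n) : dist z w ≤ dist (sheet n b z) (sheet n b' w) := by
  by_cases h : b' = b
  · rw [h, dist_sheet b hz hw]
  · obtain rfl : b' = !b := by cases b <;> cases b' <;> simp_all
    exact le_dist_sheet_not b hz hw fun p _ => dist_triangle_right _ _ _

theorem eq_of_sheet_eq {z w : ℂ} {b b' : Bool} (hz : z ∈ regularPolygon n)
    (hw : w ∈ regularPolygon n) (h : sheet n b z = sheet n b' w) : z = w := by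
  have := dist_le_dist_sheet b b' hz hw
  rw [h, dist_self] at this
  exact dist_le_zero.1 this

/-- A point off the frontier is at positive distance from it, and reaching the other sheet costs at
least that distance. -/
theorem mem_frontier_of_sheet_eq {z w : ℂ} {b b' : Bool} (hz : z ∈ regularPolygon n)
    (hw : w ∈ regularPolygon n) (hb : b ≠ b') (h : sheet n b z = sheet n b' w) :
    z ∈ frontier (regularPolygon n) := by
  obtain rfl : b' = !b := by cases b <;> cases b' <;> simp_all
  by_contra hzf
  obtain ⟨r, hr, hball⟩ := Metric.isOpen_iff.1 isClosed_frontier.isOpen_compl z hzf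
  have := le_dist_sheet_not (r := r) b hz hw fun p hp => by
    have : r ≤ dist p z := not_lt.1 fun hlt => hball hlt hp
    rw [dist_comm] at this
    linarith [dist_nonneg (x := w) (y := p)]
  rw [h, dist_self] at this
  linarith

/-- Law of reflection: a segment that reaches the boundary point `c` with velocity `d` continues
as a locally shortest path in the other sheet with velocity `d'`, provided that the boundary near
`c` is orthogonal to `d - d'`. -/
theorem dist_sheet_of_reflection {c d d' : ℂ} {r a a' : ℝ} (b : Bool)
    (hc : c ∈ frontier (regularPolygon n)) (hd : ‖d‖ = 1) (hd' : ‖d'‖ = 1)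
    (h : ∀ p ∈ frontier (regularPolygon n), dist p c < r → inner ℝ (p - c) d = inner ℝ (p - c) d')
    (ha : 0 ≤ a) (ha' : 0 ≤ a') (har : a + a' ≤ r)
    (hz : c - (a : ℂ) * d ∈ regularPolygon n) (hw : c + (a' : ℂ) * d' ∈ regularPolygon n) :
    dist (sheet n b (c - (a : ℂ) * d)) (sheet n (!b) (c + (a' : ℂ) * d')) = a + a' := by
  have e1 : dist (c - (a : ℂ) * d) c = a := by simp [hd, abs_of_nonneg ha]
  have e2 : dist (c + (a' : ℂ) * d') c = a' := by simp [hd', abs_of_nonneg ha']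
  have hc' := regularPolygon_frontier_subset hc
  apply le_antisymm
  · calc _ ≤ dist (sheet n b (c - (a : ℂ) * d)) (sheet n b c) +
          dist (sheet n b c) (sheet n (!b) (c + (a' : ℂ) * d')) := dist_triangle _ _ _
      _ = a + a' := by
          rw [dist_sheet b hz hc', sheet_eq_of_mem_frontier hc b (!b), dist_sheet _ hc' hw, e1,
            dist_comm, e2]
  · refine le_dist_sheet_not b hz hw fun p hp => ?_
    -- For `p` near `c`, bound the two distances below by projections onto `d` and `d'`: the
    -- contributions of `p - c` cancel by `h`, leaving `a + a'`. For `p` far from `c`, the triangle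
    -- inequality gives at least `2r - a - a' ≥ a + a'`.
    by_cases hpr : dist p c < r
    · have h0 := h p hp hpr
      have i1 : inner ℝ (p - (c - (a : ℂ) * d)) d ≤ dist (c - (a : ℂ) * d) p := by
        rw [dist_comm, dist_eq_norm]
        simpa [hd] using real_inner_le_norm (p - (c - (a : ℂ) * d)) d
      have i2 : inner ℝ ((c + (a' : ℂ) * d') - p) d' ≤ dist (c + (a' : ℂ) * d') p := by
        rw [dist_eq_norm]
        simpa [hd'] using real_inner_le_norm ((c + (a' : ℂ) * d') - p) d'
      have j1 : inner ℝ (p - (c - (a : ℂ) * d)) d = inner ℝ (p - c) d + a := by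
        rw [show p - (c - (a : ℂ) * d) = (p - c) + a • d by simp; ring, inner_add_left,
          real_inner_smul_left, real_inner_self_eq_norm_sq, hd]
        ring
      have j2 : inner ℝ ((c + (a' : ℂ) * d') - p) d' = a' - inner ℝ (p - c) d' := by
        rw [show (c + (a' : ℂ) * d') - p = a' • d' - (p - c) by simp; ring, inner_sub_left,
          real_inner_smul_left, real_inner_self_eq_norm_sq, hd']
        ring
      linarith
    · have t1 := dist_triangle_left p c (c - (a : ℂ) * d)
      have t2 := dist_triangle_left p c (c + (a' : ℂ) * d')
      linarith

theorem injOn_sheet (b : Bool) : InjOn (sheet n b) (regularPolygon n) :=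
  fun _ hz _ hw h => eq_of_sheet_eq hz hw h

open Function in
theorem invFunOn_sheet {z : ℂ} (b : Bool) (hz : z ∈ regularPolygon n) :
    invFunOn (sheet n b) (regularPolygon n) (sheet n b z) = z :=
  (injOn_sheet b).leftInvOn_invFunOn hz

/-- The frontier is at distance at least `r` from `c`, so a point at distance less than `r` cannot
lie only in the other sheet. This makes the inverse of a sheet a flat chart. -/
theorem sheet_image_ball {c : ℂ} {r : ℝ} (b : Bool) (hr : 0 < r)
    (h : ball c r ⊆ interior (regularPolygon n)) :
    sheet n b '' ball c r = ball (sheet n b c) r := by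
  have hH : ball c r ⊆ regularPolygon n := h.trans interior_subset
  have hc : c ∈ regularPolygon n := hH (mem_ball_self hr)
  ext x
  constructor
  · rintro ⟨z, hz, rfl⟩
    rwa [mem_ball, dist_sheet b (hH hz) hc]
  · intro hx
    obtain ⟨b', z, hz, rfl⟩ := exists_eq_sheet x
    refine ⟨z, lt_of_le_of_lt (dist_le_dist_sheet b' b hz hc) hx, ?_⟩
    by_contra hne
    have hb : b' = !b := by
      cases b <;> cases b' <;> simp at hne ⊢
    have : r ≤ dist (sheet n b c) (sheet n (!b) z) := le_dist_sheet_not b hc hz fun p hp => by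
      have : r ≤ dist p c := not_lt.1 fun hlt => hp.2 (h hlt)
      rw [dist_comm] at this
      linarith [dist_nonneg (x := z) (y := p)]
    rw [mem_ball, dist_comm, hb] at hx
    linarith

/-- The chart of the doubled polygon, around an interior point of a sheet, that identifies the
sheet with the polygon. -/
noncomputable def sheetChart {c : ℂ} {r : ℝ} (b : Bool) (hr : 0 < r)
    (h : ball c r ⊆ interior (regularPolygon n)) : FlatChart (DoubledPolygon n) (sheet n b c) where
  toFun := Function.invFunOn (sheet n b) (regularPolygon n)
  radius := r
  radius_pos := hr
  isometric := by
    rw [← sheet_image_ball b hr h]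
    rintro _ ⟨z, hz, rfl⟩ _ ⟨w, hw, rfl⟩
    have hz := interior_subset (h hz)
    have hw := interior_subset (h hw)
    rw [invFunOn_sheet b hz, invFunOn_sheet b hw, dist_sheet b hz hw]
  image_ball := by
    have hH : ball c r ⊆ regularPolygon n := h.trans interior_subset
    rw [← sheet_image_ball b hr h, invFunOn_sheet b (hH (mem_ball_self hr)), image_image,
      image_congr fun z hz => invFunOn_sheet b (hH hz), image_id']

end Sheets

/-! ### Locally shortest paths -/

section LocallyShortest

variable {X : Type*} [MetricSpace X]

/-- `γ` is, near the time `t`, distance preserving on the set `S` of times. -/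
def IsGeodesicAt (γ : ℝ → X) (S : Set ℝ) (t : ℝ) : Prop :=
  ∃ ε > 0, ∀ s ∈ S ∩ ball t ε, ∀ s' ∈ S ∩ ball t ε, dist (γ s) (γ s') = |s - s'|

theorem IsGeodesicAt.of_le {γ : ℝ → X} {S : Set ℝ} {t : ℝ} {ε : ℝ} (hε : 0 < ε)
    (h : ∀ s ∈ S ∩ ball t ε, ∀ s' ∈ S ∩ ball t ε, s ≤ s' → dist (γ s) (γ s') = s' - s) :
    IsGeodesicAt γ S t := by
  refine ⟨ε, hε, fun s hs s' hs' => ?_⟩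
  rcases le_total s s' with hle | hle
  · rw [h s hs s' hs' hle, abs_sub_comm, abs_of_nonneg (sub_nonneg.2 hle)]
  · rw [dist_comm, h s' hs' s hs hle, abs_of_nonneg (sub_nonneg.2 hle)]

theorem IsGeodesicAt.congr_set {γ : ℝ → X} {S T : Set ℝ} {t δ : ℝ} (h : IsGeodesicAt γ S t)
    (hδ : 0 < δ) (hST : ∀ s ∈ T, dist s t < δ → s ∈ S) : IsGeodesicAt γ T t := by
  obtain ⟨ε, hε, H⟩ := h
  refine ⟨min ε δ, lt_min hε hδ, fun s hs s' hs' => ?_⟩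
  have aux : ∀ s ∈ T ∩ ball t (min ε δ), s ∈ S ∩ ball t ε := fun s hs =>
    ⟨hST s hs.1 (lt_of_lt_of_le hs.2 (min_le_right _ _)), ball_subset_ball (min_le_left _ _) hs.2⟩
  exact H s (aux s hs) s' (aux s' hs')

theorem isGeodesicAt_Icc_append {γ : ℝ → X} {a b c : ℝ}
    (h₁ : ∀ t ∈ Icc a b, IsGeodesicAt γ (Icc a b) t)
    (h₂ : ∀ t ∈ Icc b c, IsGeodesicAt γ (Icc b c) t) (hb : IsGeodesicAt γ (Icc a c) b) :
    ∀ t ∈ Icc a c, IsGeodesicAt γ (Icc a c) t := by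
  intro t ht
  rcases lt_trichotomy t b with h | rfl | h
  · refine (h₁ t ⟨ht.1, h.le⟩).congr_set (sub_pos.2 h) fun s hs hst => ⟨hs.1, ?_⟩
    rw [Real.dist_eq] at hst
    linarith [le_abs_self (s - t)]
  · exact hb
  · refine (h₂ t ⟨h.le, ht.2⟩).congr_set (sub_pos.2 h) fun s hs hst => ⟨?_, hs.2⟩
    rw [Real.dist_eq] at hst
    linarith [neg_abs_le (s - t)]

end LocallyShortest

/-! ### Straight pieces and bounces in a doubled polygon -/

section Polylines

variable {n : ℕ} [NeZero n]

/-- On `[a, b]`, the path `γ` runs in one sheet with constant planar velocity `d`, and is at `c`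
at the time `a`. -/
def RunsStraight (γ : ℝ → DoubledPolygon n) (σ : Bool) (a b : ℝ) (c d : ℂ) : Prop :=
  ∀ t ∈ Icc a b, c + ((t - a : ℝ) : ℂ) * d ∈ regularPolygon n ∧
    γ t = sheet n σ (c + ((t - a : ℝ) : ℂ) * d)

theorem RunsStraight.dist_eq {γ : ℝ → DoubledPolygon n} {σ : Bool} {a b : ℝ} {c d : ℂ}
    (h : RunsStraight γ σ a b c d) (hd : ‖d‖ = 1) {s s' : ℝ} (hs : s ∈ Icc a b)
    (hs' : s' ∈ Icc a b) : dist (γ s) (γ s') = |s - s'| := by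
  rw [(h s hs).2, (h s' hs').2, dist_sheet σ (h s hs).1 (h s' hs').1, dist_eq_norm,
    show c + ((s - a : ℝ) : ℂ) * d - (c + ((s' - a : ℝ) : ℂ) * d) = ((s - s' : ℝ) : ℂ) * d by
      push_cast; ring, norm_mul, hd, Complex.norm_real, Real.norm_eq_abs, mul_one]

theorem RunsStraight.isGeodesicAt {γ : ℝ → DoubledPolygon n} {σ : Bool} {a b : ℝ} {c d : ℂ}
    (h : RunsStraight γ σ a b c d) (hd : ‖d‖ = 1) (t : ℝ) : IsGeodesicAt γ (Icc a b) t :=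
  ⟨1, one_pos, fun _ hs _ hs' => h.dist_eq hd hs.1 hs'.1⟩

theorem RunsStraight.isGeodesicAt_reflection {γ : ℝ → DoubledPolygon n} {σ : Bool} {a b e r : ℝ}
    {c₀ c d d' : ℂ} (h₁ : RunsStraight γ σ a b c₀ d) (h₂ : RunsStraight γ (!σ) b e c d')
    (hc₀ : c₀ + ((b - a : ℝ) : ℂ) * d = c) (hr : 0 < r)
    (hc : c ∈ frontier (regularPolygon n)) (hd : ‖d‖ = 1) (hd' : ‖d'‖ = 1)
    (h : ∀ p ∈ frontier (regularPolygon n), dist p c < r →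
      inner ℝ (p - c) d = inner ℝ (p - c) d') : IsGeodesicAt γ (Icc a e) b := by
  -- Radius `r / 2` keeps times on opposite sides of `b` within `r` of each other, as
  -- `dist_sheet_of_reflection` requires.
  refine IsGeodesicAt.of_le (half_pos hr) fun s hs s' hs' hle => ?_
  have hs2 := abs_lt.1 (Real.dist_eq s b ▸ hs.2 : |s - b| < r / 2)
  have hs2' := abs_lt.1 (Real.dist_eq s' b ▸ hs'.2 : |s' - b| < r / 2)
  rcases le_or_gt s' b with h' | h'
  · rw [h₁.dist_eq hd ⟨hs.1.1, hle.trans h'⟩ ⟨hs'.1.1, h'⟩, abs_sub_comm,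
      abs_of_nonneg (sub_nonneg.2 hle)]
  rcases le_or_gt b s with h'' | h''
  · rw [h₂.dist_eq hd' ⟨h'', hs.1.2⟩ ⟨h'.le, hs'.1.2⟩, abs_sub_comm,
      abs_of_nonneg (sub_nonneg.2 hle)]
  obtain ⟨m₁, e₁⟩ := h₁ s ⟨hs.1.1, h''.le⟩
  obtain ⟨m₂, e₂⟩ := h₂ s' ⟨h'.le, hs'.1.2⟩
  have e₃ : c₀ + ((s - a : ℝ) : ℂ) * d = c - ((b - s : ℝ) : ℂ) * d := by
    rw [← hc₀]; push_cast; ring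
  rw [e₃] at m₁ e₁
  rw [e₁, e₂, dist_sheet_of_reflection σ hc hd hd' h (by linarith) (by linarith) (by linarith)
    m₁ m₂]
  ring

end Polylines

/-! ### The regular hexagon -/

section Hexagon

/-- Coordinates on the plane in which the regular hexagon of circumradius `1` is given by the
inequalities `|y| ≤ 27`, `|x + y| ≤ 54`, `|x - y| ≤ 54`. -/
noncomputable def hexPoint (x y : ℝ) : ℂ := ⟨x / 54, y * √3 / 54⟩

theorem exists_eq_hexPoint (z : ℂ) : ∃ x y, z = hexPoint x y := by
  refine ⟨z.re * 54, z.im * 54 / √3, Complex.ext ?_ ?_⟩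
  · simp [hexPoint]
  · simp [hexPoint]

theorem hexPoint_inj {x y x' y' : ℝ} : hexPoint x y = hexPoint x' y' ↔ x = x' ∧ y = y' := by
  simp [hexPoint, Complex.ext_iff]

theorem hexPoint_add (x y x' y' : ℝ) :
    hexPoint x y + hexPoint x' y' = hexPoint (x + x') (y + y') := by
  apply Complex.ext <;> simp [hexPoint] <;> ring

theorem hexPoint_sub (x y x' y' : ℝ) :
    hexPoint x y - hexPoint x' y' = hexPoint (x - x') (y - y') := by
  apply Complex.ext <;> simp [hexPoint] <;> ring

theorem smul_hexPoint (r x y : ℝ) : r • hexPoint x y = hexPoint (r * x) (r * y) := by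
  apply Complex.ext <;> simp [hexPoint] <;> ring

theorem inner_hexPoint (x y x' y' : ℝ) :
    inner ℝ (hexPoint x y) (hexPoint x' y') = (x * x' + 3 * y * y') / 54 ^ 2 := by
  have h : √3 * √3 = 3 := Real.mul_self_sqrt (by norm_num)
  simp only [Complex.inner, hexPoint, Complex.mul_re, Complex.conj_re, Complex.conj_im]
  linear_combination (y * y' / 54 ^ 2) * h

theorem norm_hexPoint_sq (x y : ℝ) : ‖hexPoint x y‖ ^ 2 = (x ^ 2 + 3 * y ^ 2) / 54 ^ 2 := by
  rw [← real_inner_self_eq_norm_sq, inner_hexPoint]; ring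

theorem abs_sub_lt_of_dist_hexPoint_lt {x y x' y' r : ℝ} (hr : 0 < r)
    (h : dist (hexPoint x y) (hexPoint x' y') < r / 54) : |x - x'| < r ∧ √3 * |y - y'| < r := by
  rw [dist_eq_norm, hexPoint_sub] at h
  have h2 : ‖hexPoint (x - x') (y - y')‖ ^ 2 < (r / 54) ^ 2 :=
    pow_lt_pow_left₀ h (norm_nonneg _) two_ne_zero
  rw [norm_hexPoint_sq, div_pow, div_lt_div_iff_of_pos_right (by norm_num)] at h2
  refine ⟨abs_lt_of_sq_lt_sq (by nlinarith [sq_nonneg (y - y')]) hr.le,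
    lt_of_pow_lt_pow_left₀ 2 hr.le ?_⟩
  rw [mul_pow, sq_abs, Real.sq_sqrt (by norm_num)]
  nlinarith [sq_nonneg (x - x')]

/-- Membership in the hexagon, in terms of the coordinates of `hexPoint`. -/
def InHexagon (x y : ℝ) : Prop :=
  (-27 ≤ y ∧ y ≤ 27) ∧ (-54 ≤ x + y ∧ x + y ≤ 54) ∧ (-54 ≤ x - y ∧ x - y ≤ 54)

/-- The lines spanned by the sides of the hexagon, in terms of the coordinates of `hexPoint`. -/
def OnHexagonSide (x y : ℝ) : Prop :=
  y = -27 ∨ y = 27 ∨ x + y = -54 ∨ x + y = 54 ∨ x - y = -54 ∨ x - y = 54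

theorem polygonVertex_six (k : Fin 6) : polygonVertex 6 k =
    hexPoint (![54, 27, -27, -54, -27, 27] k) (![0, 27, 27, 0, -27, -27] k) := by
  have h : ∀ m : ℕ, Complex.exp (2 * Real.pi * Complex.I * (m : ℂ) / ((6 : ℕ) : ℂ)) =
      (⟨1 / 2, √3 / 2⟩ : ℂ) ^ m := by
    intro m
    have : (⟨1 / 2, √3 / 2⟩ : ℂ) = Complex.exp ((Real.pi / 3 : ℝ) * Complex.I) := by
      apply Complex.ext
      · rw [Complex.exp_ofReal_mul_I_re, Real.cos_pi_div_three]
      · rw [Complex.exp_ofReal_mul_I_im, Real.sin_pi_div_three]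
    rw [this, ← Complex.exp_nat_mul]
    congr 1
    push_cast
    ring
  have h3 : √3 * √3 = 3 := Real.mul_self_sqrt (by norm_num)
  have p2 : (⟨1 / 2, √3 / 2⟩ : ℂ) ^ 2 = ⟨-1 / 2, √3 / 2⟩ := by
    rw [pow_two]
    apply Complex.ext
    · simp only [Complex.mul_re]; linarith
    · simp only [Complex.mul_im]; ring
  have p3 : (⟨1 / 2, √3 / 2⟩ : ℂ) ^ 3 = -1 := by
    rw [pow_succ, p2]
    apply Complex.ext
    · simp only [Complex.mul_re, Complex.neg_re, Complex.one_re]; linarith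
    · simp only [Complex.mul_im, Complex.neg_im, Complex.one_im]; ring
  have p4 : (⟨1 / 2, √3 / 2⟩ : ℂ) ^ 4 = -⟨1 / 2, √3 / 2⟩ := by
    rw [pow_succ, p3, neg_one_mul]
  have p5 : (⟨1 / 2, √3 / 2⟩ : ℂ) ^ 5 = -⟨-1 / 2, √3 / 2⟩ := by
    rw [show 5 = 3 + 2 from rfl, pow_add, p3, p2, neg_one_mul]
  rw [polygonVertex, h]
  fin_cases k
  · apply Complex.ext <;> simp [hexPoint]
  · apply Complex.ext <;> simp [hexPoint] <;> ring
  · rw [p2]; apply Complex.ext <;> simp [hexPoint] <;> ring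
  · rw [p3]; apply Complex.ext <;> simp [hexPoint]
  · rw [p4]; apply Complex.ext <;> simp [hexPoint] <;> ring
  · rw [p5]; apply Complex.ext <;> simp [hexPoint] <;> ring

theorem convex_setOf_inHexagon : Convex ℝ {z | ∃ x y, InHexagon x y ∧ z = hexPoint x y} := by
  rintro _ ⟨x, y, ⟨⟨h1, h2⟩, ⟨h3, h4⟩, h5, h6⟩, rfl⟩ _
    ⟨x', y', ⟨⟨h1', h2'⟩, ⟨h3', h4'⟩, h5', h6'⟩, rfl⟩ a b ha hb hab
  refine ⟨a * x + b * x', a * y + b * y', ?_, by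
    rw [smul_hexPoint, smul_hexPoint, hexPoint_add]⟩
  obtain rfl : b = 1 - a := by linarith
  refine ⟨⟨?_, ?_⟩, ⟨?_, ?_⟩, ?_, ?_⟩ <;> nlinarith

/-- The inequalities hold at the vertices and cut out a convex set. Conversely, the horizontal slice
at height `y` is the segment `|x| ≤ 54 - |y|`, whose endpoints lie on slanted sides and so are
convex combinations of two vertices. -/
theorem hexPoint_mem_iff {x y : ℝ} : hexPoint x y ∈ regularPolygon 6 ↔ InHexagon x y := by
  constructor
  · intro h
    have : hexPoint x y ∈ {z | ∃ x y, InHexagon x y ∧ z = hexPoint x y} := by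
      refine convexHull_min ?_ convex_setOf_inHexagon h
      rintro _ ⟨k, rfl⟩
      refine ⟨_, _, ?_, polygonVertex_six k⟩
      fin_cases k <;> norm_num [InHexagon]
    obtain ⟨x', y', h', e⟩ := this
    obtain ⟨rfl, rfl⟩ := hexPoint_inj.1 e
    exact h'
  · rintro ⟨⟨h1, h2⟩, ⟨h3, h4⟩, h5, h6⟩
    have hconv : Convex ℝ (regularPolygon 6) := convex_convexHull ℝ _
    have hv : ∀ k : Fin 6,
        hexPoint (![54, 27, -27, -54, -27, 27] k) (![0, 27, 27, 0, -27, -27] k) ∈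
          regularPolygon 6 := fun k => by
      rw [← polygonVertex_six]; exact polygonVertex_mem 6 k
    have comb : ∀ {x₁ y₁ x₂ y₂ : ℝ} (a : ℝ), hexPoint x₁ y₁ ∈ regularPolygon 6 →
        hexPoint x₂ y₂ ∈ regularPolygon 6 → 0 ≤ a → a ≤ 1 →
        hexPoint (a * x₁ + (1 - a) * x₂) (a * y₁ + (1 - a) * y₂) ∈ regularPolygon 6 := by
      intro x₁ y₁ x₂ y₂ a m₁ m₂ h₀ h₁
      have := hconv m₁ m₂ h₀ (sub_nonneg.2 h₁) (by ring)
      rwa [smul_hexPoint, smul_hexPoint, hexPoint_add] at this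
    have across : ∀ {w : ℝ}, 0 < w → -w ≤ x → x ≤ w → hexPoint w y ∈ regularPolygon 6 →
        hexPoint (-w) y ∈ regularPolygon 6 → hexPoint x y ∈ regularPolygon 6 := by
      intro w hw hx₁ hx₂ m₁ m₂
      have := comb ((x + w) / (2 * w)) m₁ m₂ (by apply div_nonneg <;> linarith)
        ((div_le_one (by linarith)).2 (by linarith))
      convert this using 2
      · field_simp; ring
      · ring
    rcases le_total 0 y with hy | hy
    · refine across (w := 54 - y) (by linarith) (by linarith) (by linarith) ?_ ?_
      · have := comb (y / 27) (hv 1) (hv 0) (by positivity) (by linarith)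
        convert this using 2
        · simp; ring
        · simp
      · have := comb (y / 27) (hv 2) (hv 3) (by positivity) (by linarith)
        convert this using 2
        · simp; ring
        · simp
    · refine across (w := 54 + y) (by linarith) (by linarith) (by linarith) ?_ ?_
      · have := comb (-y / 27) (hv 5) (hv 0) (by linarith) (by linarith)
        convert this using 2
        · simp; ring
        · simp
      · have := comb (-y / 27) (hv 4) (hv 3) (by linarith) (by linarith)
        convert this using 2
        · simp; ring
        · simp

theorem onHexagonSide_of_mem_frontier {x y : ℝ} (h : hexPoint x y ∈ frontier (regularPolygon 6)) :
    OnHexagonSide x y := by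
  by_contra hn
  simp only [OnHexagonSide, not_or] at hn
  obtain ⟨n1, n2, n3, n4, n5, n6⟩ := hn
  obtain ⟨⟨h1, h2⟩, ⟨h3, h4⟩, h5, h6⟩ := hexPoint_mem_iff.1 (regularPolygon_frontier_subset h)
  -- The strict inequalities define an open subset of the hexagon. Multiplying them by `54 * √3` or
  -- `√3` expresses them through `re` and `im` without division.
  refine h.2 (interior_maximal (s := regularPolygon 6)
    (t := {z : ℂ | (-(27 * √3) < 54 * z.im ∧ 54 * z.im < 27 * √3) ∧
      (-(54 * √3) < 54 * (√3 * z.re + z.im) ∧ 54 * (√3 * z.re + z.im) < 54 * √3) ∧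
      (-(54 * √3) < 54 * (√3 * z.re - z.im) ∧ 54 * (√3 * z.re - z.im) < 54 * √3)}) ?_ ?_ ?_)
  · intro z hz
    obtain ⟨x', y', rfl⟩ := exists_eq_hexPoint z
    obtain ⟨⟨g1, g2⟩, ⟨g3, g4⟩, g5, g6⟩ := hz
    have hpos : 0 < √3 := by positivity
    simp only [hexPoint] at g1 g2 g3 g4 g5 g6
    refine hexPoint_mem_iff.2 ⟨⟨?_, ?_⟩, ⟨?_, ?_⟩, ?_, ?_⟩ <;>
    refine le_of_mul_le_mul_right ?_ hpos <;> linarith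
  · refine IsOpen.and (IsOpen.and ?_ ?_) (IsOpen.and (IsOpen.and ?_ ?_) (IsOpen.and ?_ ?_)) <;>
    exact isOpen_lt (by fun_prop) (by fun_prop)
  · have hpos : 0 < √3 := by positivity
    have k1 := mul_lt_mul_of_pos_right (lt_of_le_of_ne h1 (Ne.symm n1)) hpos
    have k2 := mul_lt_mul_of_pos_right (lt_of_le_of_ne h2 n2) hpos
    have k3 := mul_lt_mul_of_pos_right (lt_of_le_of_ne h3 (Ne.symm n3)) hpos
    have k4 := mul_lt_mul_of_pos_right (lt_of_le_of_ne h4 n4) hpos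
    have k5 := mul_lt_mul_of_pos_right (lt_of_le_of_ne h5 (Ne.symm n5)) hpos
    have k6 := mul_lt_mul_of_pos_right (lt_of_le_of_ne h6 n6) hpos
    simp only [hexPoint, mem_ofPred_eq]
    refine ⟨⟨?_, ?_⟩, ⟨?_, ?_⟩, ?_, ?_⟩ <;> linarith

/-- Scaling such a point by any factor `r > 1` violates the inequality of its side, whereas an
interior point stays in the hexagon for `r` close to `1`. -/
theorem mem_frontier_of_onHexagonSide {x y : ℝ} (h : InHexagon x y) (hs : OnHexagonSide x y) :
    hexPoint x y ∈ frontier (regularPolygon 6) := by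
  refine ⟨subset_closure (hexPoint_mem_iff.2 h), fun hint => ?_⟩
  have hcont : Continuous fun r : ℝ => hexPoint (r * x) (r * y) := by
    simp_rw [← smul_hexPoint]; fun_prop
  have hev : ∀ᶠ r in nhds (1 : ℝ), hexPoint (r * x) (r * y) ∈ interior (regularPolygon 6) :=
    hcont.continuousAt.eventually (isOpen_interior.mem_nhds (by simpa using hint))
  obtain ⟨r, hr, hr1⟩ := ((hev.filter_mono nhdsWithin_le_nhds).and
    (self_mem_nhdsWithin : Ioi (1 : ℝ) ∈ nhdsWithin 1 (Ioi 1))).exists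
  obtain ⟨⟨h1, h2⟩, ⟨h3, h4⟩, h5, h6⟩ := hexPoint_mem_iff.1 (interior_subset hr)
  have hr1 : 1 < r := hr1
  rcases hs with e | e | e | e | e | e
  · rw [e] at h1; linarith
  · rw [e] at h2; linarith
  · rw [← mul_add, e] at h3; linarith
  · rw [← mul_add, e] at h4; linarith
  · rw [← mul_sub, e] at h5; linarith
  · rw [← mul_sub, e] at h6; linarith

theorem eq_and_eq_of_sheet_hexPoint_eq {x y x' y' : ℝ} {b b' : Bool} (h : InHexagon x y)
    (h' : InHexagon x' y') (e : sheet 6 b (hexPoint x y) = sheet 6 b' (hexPoint x' y')) :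
    x = x' ∧ y = y' ∧ (b = b' ∨ OnHexagonSide x y) := by
  rw [← hexPoint_mem_iff] at h h'
  obtain ⟨hx, hy⟩ := hexPoint_inj.1 (eq_of_sheet_eq h h' e)
  refine ⟨hx, hy, or_iff_not_imp_left.2 fun hb => ?_⟩
  exact onHexagonSide_of_mem_frontier (mem_frontier_of_sheet_eq h h' hb e)

end Hexagon

/-! ### The two explicit loops -/

section Loops

/-- The unit vector with coordinates proportional to `(u, v)` when `u ^ 2 + 3 * v ^ 2 = 7`. -/
noncomputable def hexDirection (u v : ℝ) : ℂ := (54 / √7) • hexPoint u v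

theorem norm_hexDirection {u v : ℝ} (h : u ^ 2 + 3 * v ^ 2 = 7) : ‖hexDirection u v‖ = 1 := by
  have h7 : √7 ^ 2 = 7 := Real.sq_sqrt (by norm_num)
  have : ‖hexDirection u v‖ ^ 2 = 1 := by
    rw [hexDirection, norm_smul, mul_pow, norm_hexPoint_sq, h, Real.norm_eq_abs, sq_abs, div_pow,
      h7]
    norm_num
  exact (pow_eq_one_iff_of_nonneg (norm_nonneg _) two_ne_zero).1 this

theorem inner_hexDirection (u v u' v' : ℝ) :
    inner ℝ (hexDirection u v) (hexDirection u' v') = (u * u' + 3 * v * v') / 7 := by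
  have h7 : √7 ^ 2 = 7 := Real.sq_sqrt (by norm_num)
  rw [hexDirection, hexDirection, real_inner_smul_left, real_inner_smul_right, inner_hexPoint]
  field_simp
  rw [h7]
  ring

theorem hexPoint_add_mul_hexDirection (x y u v t : ℝ) :
    hexPoint x y + (t : ℂ) * hexDirection u v =
      hexPoint (x + 54 / √7 * t * u) (y + 54 / √7 * t * v) := by
  rw [← Complex.real_smul, hexDirection, smul_smul, smul_hexPoint, hexPoint_add, mul_comm t]

/-- A path in the doubled hexagon, reparametrized by arc length when its velocity in the
coordinates of `hexPoint` is of the form `(u, v)` with `u ^ 2 + 3 * v ^ 2 = 7`. -/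
noncomputable def unitSpeed (f : ℝ → DoubledPolygon 6) (t : ℝ) : DoubledPolygon 6 :=
  f (54 / √7 * t)

theorem unitSpeed_apply_mul (f : ℝ → DoubledPolygon 6) (s : ℝ) :
    unitSpeed f (√7 / 54 * s) = f s := by
  rw [unitSpeed]
  congr 1
  field_simp

theorem mem_Icc_of_mem_Icc_mul {a b t : ℝ} (ht : t ∈ Icc (√7 / 54 * a) (√7 / 54 * b)) :
    54 / √7 * t ∈ Icc a b := by
  have e : t = √7 / 54 * (54 / √7 * t) := by field_simp
  have hpos : 0 < √7 / 54 := by positivity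
  rw [e] at ht
  exact ⟨le_of_mul_le_mul_left ht.1 hpos, le_of_mul_le_mul_left ht.2 hpos⟩

theorem mem_Ioo_of_mem_Ioo_mul {b t : ℝ} (ht : t ∈ Ioo 0 (√7 / 54 * b)) :
    54 / √7 * t ∈ Ioo 0 b := by
  have e : t = √7 / 54 * (54 / √7 * t) := by field_simp
  have hpos : 0 < √7 / 54 := by positivity
  refine ⟨mul_pos (by positivity) ht.1, lt_of_mul_lt_mul_left ?_ hpos.le⟩
  rw [← e]
  exact ht.2

theorem runsStraight_unitSpeed {f : ℝ → DoubledPolygon 6} {σ : Bool} {a b x y u v : ℝ}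
    (h : ∀ s ∈ Icc a b, InHexagon (x + (s - a) * u) (y + (s - a) * v) ∧
      f s = sheet 6 σ (hexPoint (x + (s - a) * u) (y + (s - a) * v))) :
    RunsStraight (unitSpeed f) σ (√7 / 54 * a) (√7 / 54 * b) (hexPoint x y)
      (hexDirection u v) := by
  intro t ht
  obtain ⟨h1, h2⟩ := h _ (mem_Icc_of_mem_Icc_mul ht)
  have e : 54 / √7 * (t - √7 / 54 * a) = 54 / √7 * t - a := by field_simp
  rw [hexPoint_add_mul_hexDirection, e]
  exact ⟨hexPoint_mem_iff.2 h1, h2⟩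

theorem isGeodesicAt_unitSpeed {f : ℝ → DoubledPolygon 6} {σ : Bool}
    {a b e x y x' y' u v u' v' : ℝ}
    (h₁ : RunsStraight (unitSpeed f) σ (√7 / 54 * a) (√7 / 54 * b) (hexPoint x y)
      (hexDirection u v))
    (h₂ : RunsStraight (unitSpeed f) (!σ) (√7 / 54 * b) (√7 / 54 * e) (hexPoint x' y')
      (hexDirection u' v'))
    (hx : x + (b - a) * u = x') (hy : y + (b - a) * v = y')
    (hin : InHexagon x' y') (hs : OnHexagonSide x' y')
    (hn : u ^ 2 + 3 * v ^ 2 = 7) (hn' : u' ^ 2 + 3 * v' ^ 2 = 7)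
    (h : ∀ p q, OnHexagonSide p q → |p - x'| < 1 / 2 → |q - y'| < 1 / 2 →
      (p - x') * u + 3 * (q - y') * v = (p - x') * u' + 3 * (q - y') * v') :
    IsGeodesicAt (unitSpeed f) (Icc (√7 / 54 * a) (√7 / 54 * e)) (√7 / 54 * b) := by
  refine h₁.isGeodesicAt_reflection h₂ (r := 1 / 2 / 54) ?_ (by norm_num)
    (mem_frontier_of_onHexagonSide hin hs) (norm_hexDirection hn) (norm_hexDirection hn') ?_
  · rw [hexPoint_add_mul_hexDirection, ← hx, ← hy]
    congr 2 <;> field_simp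
  · intro z hz hd
    obtain ⟨p, q, rfl⟩ := exists_eq_hexPoint z
    obtain ⟨d1, d2⟩ := abs_sub_lt_of_dist_hexPoint_lt (by norm_num) hd
    -- The radius `1 / 2` is small enough that, near each bounce point used below, only the side
    -- being hit is met.
    have d3 : |q - y'| < 1 / 2 := by
      have : 1 ≤ √3 := Real.one_le_sqrt.2 (by norm_num)
      nlinarith [abs_nonneg (q - y')]
    rw [hexPoint_sub, hexDirection, hexDirection, real_inner_smul_right, real_inner_smul_right,
      inner_hexPoint, inner_hexPoint, h p q (onHexagonSide_of_mem_frontier hz) d1 d3]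

open Classical in
/-- The first loop of the figure-eight: it changes sheets four times. -/
noncomputable def fourCrossingLoop (s : ℝ) : DoubledPolygon 6 :=
  if s ≤ 12 then sheet 6 true (hexPoint (36 + (s - 0) * (-1 / 2)) (6 + (s - 0) * (3 / 2)))
  else if s ≤ 15 then sheet 6 false (hexPoint (30 + (s - 12) * (-2)) (24 + (s - 12) * 1))
  else if s ≤ 50 then sheet 6 true (hexPoint (24 + (s - 15) * (-2)) (27 + (s - 15) * (-1)))
  else if s ≤ 86 then sheet 6 false (hexPoint (-46 + (s - 50) * (5 / 2)) (-8 + (s - 50) * (1 / 2)))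
  else sheet 6 true (hexPoint (44 + (s - 86) * (-2)) (10 + (s - 86) * (-1)))

open Classical in
/-- The second loop of the figure-eight: it changes sheets twice. -/
noncomputable def twoCrossingLoop (s : ℝ) : DoubledPolygon 6 :=
  if s ≤ 32 then sheet 6 true (hexPoint (36 + (s - 0) * (-2)) (6 + (s - 0) * (-1)))
  else if s ≤ 60 then
    sheet 6 false (hexPoint (-28 + (s - 32) * (5 / 2)) (-26 + (s - 32) * (1 / 2)))
  else sheet 6 true (hexPoint (42 + (s - 60) * (-1 / 2)) (-12 + (s - 60) * (3 / 2)))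

/-- The position `(x, y)` in the sheet `b` of a point of the first loop at the time `s`. -/
def FourCrossingLoopAt (s : ℝ) (b : Bool) (x y : ℝ) : Prop :=
  (0 ≤ s ∧ s ≤ 12 ∧ b = true ∧ x = 36 + (s - 0) * (-1 / 2) ∧ y = 6 + (s - 0) * (3 / 2)) ∨
  (12 < s ∧ s ≤ 15 ∧ b = false ∧ x = 30 + (s - 12) * (-2) ∧ y = 24 + (s - 12) * 1) ∨
  (15 < s ∧ s ≤ 50 ∧ b = true ∧ x = 24 + (s - 15) * (-2) ∧ y = 27 + (s - 15) * (-1)) ∨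
  (50 < s ∧ s ≤ 86 ∧ b = false ∧ x = -46 + (s - 50) * (5 / 2) ∧ y = -8 + (s - 50) * (1 / 2)) ∨
  (86 < s ∧ s ≤ 90 ∧ b = true ∧ x = 44 + (s - 86) * (-2) ∧ y = 10 + (s - 86) * (-1))

/-- The position `(x, y)` in the sheet `b` of a point of the second loop at the time `s`. -/
def TwoCrossingLoopAt (s : ℝ) (b : Bool) (x y : ℝ) : Prop :=
  (0 ≤ s ∧ s ≤ 32 ∧ b = true ∧ x = 36 + (s - 0) * (-2) ∧ y = 6 + (s - 0) * (-1)) ∨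
  (32 < s ∧ s ≤ 60 ∧ b = false ∧ x = -28 + (s - 32) * (5 / 2) ∧ y = -26 + (s - 32) * (1 / 2)) ∨
  (60 < s ∧ s ≤ 72 ∧ b = true ∧ x = 42 + (s - 60) * (-1 / 2) ∧ y = -12 + (s - 60) * (3 / 2))

/-! ### Embeddedness of the loops and avoidance of the cone points -/

theorem exists_fourCrossingLoopAt {s : ℝ} (hs : s ∈ Icc 0 90) : ∃ b x y,
    FourCrossingLoopAt s b x y ∧ InHexagon x y ∧ fourCrossingLoop s = sheet 6 b (hexPoint x y) := by
  obtain ⟨h0, h1⟩ := hs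
  unfold fourCrossingLoop FourCrossingLoopAt
  split_ifs with h2 h3 h4 h5
  · refine ⟨_, _, _, Or.inl ⟨h0, h2, rfl, rfl, rfl⟩, ?_, rfl⟩
    refine ⟨⟨?_, ?_⟩, ⟨?_, ?_⟩, ?_, ?_⟩ <;> linarith
  · refine ⟨_, _, _, Or.inr <| Or.inl ⟨not_le.1 h2, h3, rfl, rfl, rfl⟩, ?_, rfl⟩
    refine ⟨⟨?_, ?_⟩, ⟨?_, ?_⟩, ?_, ?_⟩ <;> linarith
  · refine ⟨_, _, _, Or.inr <| Or.inr <| Or.inl ⟨not_le.1 h3, h4, rfl, rfl, rfl⟩, ?_, rfl⟩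
    refine ⟨⟨?_, ?_⟩, ⟨?_, ?_⟩, ?_, ?_⟩ <;> linarith
  · refine ⟨_, _, _, Or.inr <| Or.inr <| Or.inr <| Or.inl ⟨not_le.1 h4, h5, rfl, rfl, rfl⟩, ?_,
      rfl⟩
    refine ⟨⟨?_, ?_⟩, ⟨?_, ?_⟩, ?_, ?_⟩ <;> linarith
  · refine ⟨_, _, _, Or.inr <| Or.inr <| Or.inr <| Or.inr ⟨not_le.1 h5, h1, rfl, rfl, rfl⟩, ?_,
      rfl⟩
    refine ⟨⟨?_, ?_⟩, ⟨?_, ?_⟩, ?_, ?_⟩ <;> linarith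

theorem exists_twoCrossingLoopAt {s : ℝ} (hs : s ∈ Icc 0 72) : ∃ b x y,
    TwoCrossingLoopAt s b x y ∧ InHexagon x y ∧ twoCrossingLoop s = sheet 6 b (hexPoint x y) := by
  obtain ⟨h0, h1⟩ := hs
  unfold twoCrossingLoop TwoCrossingLoopAt
  split_ifs with h2 h3
  · refine ⟨_, _, _, Or.inl ⟨h0, h2, rfl, rfl, rfl⟩, ?_, rfl⟩
    refine ⟨⟨?_, ?_⟩, ⟨?_, ?_⟩, ?_, ?_⟩ <;> linarith
  · refine ⟨_, _, _, Or.inr <| Or.inl ⟨not_le.1 h2, h3, rfl, rfl, rfl⟩, ?_, rfl⟩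
    refine ⟨⟨?_, ?_⟩, ⟨?_, ?_⟩, ?_, ?_⟩ <;> linarith
  · refine ⟨_, _, _, Or.inr <| Or.inr ⟨not_le.1 h3, h1, rfl, rfl, rfl⟩, ?_, rfl⟩
    refine ⟨⟨?_, ?_⟩, ⟨?_, ?_⟩, ?_, ?_⟩ <;> linarith

theorem fourCrossingLoop_injOn {s s' : ℝ} (hs : s ∈ Ioo 0 90) (hs' : s' ∈ Ioo 0 90)
    (h : fourCrossingLoop s = fourCrossingLoop s') : s = s' := by
  obtain ⟨b, x, y, h1, h2, h3⟩ := exists_fourCrossingLoopAt (Ioo_subset_Icc_self hs)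
  obtain ⟨b', x', y', h1', h2', h3'⟩ := exists_fourCrossingLoopAt (Ioo_subset_Icc_self hs')
  rw [h3, h3'] at h
  obtain ⟨ex, ey, eb⟩ := eq_and_eq_of_sheet_hexPoint_eq h2 h2' h
  obtain ⟨p1, p2⟩ := hs
  obtain ⟨p1', p2'⟩ := hs'
  rcases h1 with ⟨a1, a2, rfl, a3, a4⟩ | ⟨a1, a2, rfl, a3, a4⟩ | ⟨a1, a2, rfl, a3, a4⟩ |
    ⟨a1, a2, rfl, a3, a4⟩ | ⟨a1, a2, rfl, a3, a4⟩ <;>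
  rcases h1' with ⟨b1, b2, rfl, b3, b4⟩ | ⟨b1, b2, rfl, b3, b4⟩ | ⟨b1, b2, rfl, b3, b4⟩ |
    ⟨b1, b2, rfl, b3, b4⟩ | ⟨b1, b2, rfl, b3, b4⟩ <;>
  -- The planar traces of the first and fourth pieces cross, but inside the hexagon and on opposite
  -- sheets. Only there are the sheets needed; planar positions decide the other pairs.
  first
  | linarith
  | (rcases eb.resolve_left (by decide) with e | e | e | e | e | e <;> linarith)

/-- The planar trace of this loop is a triangle, so planar positions alone suffice. -/
theorem twoCrossingLoop_injOn {s s' : ℝ} (hs : s ∈ Ioo 0 72) (hs' : s' ∈ Ioo 0 72)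
    (h : twoCrossingLoop s = twoCrossingLoop s') : s = s' := by
  obtain ⟨b, x, y, h1, h2, h3⟩ := exists_twoCrossingLoopAt (Ioo_subset_Icc_self hs)
  obtain ⟨b', x', y', h1', h2', h3'⟩ := exists_twoCrossingLoopAt (Ioo_subset_Icc_self hs')
  rw [h3, h3'] at h
  obtain ⟨ex, ey, eb⟩ := eq_and_eq_of_sheet_hexPoint_eq h2 h2' h
  obtain ⟨p1, p2⟩ := hs
  obtain ⟨p1', p2'⟩ := hs'
  rcases h1 with ⟨a1, a2, rfl, a3, a4⟩ | ⟨a1, a2, rfl, a3, a4⟩ | ⟨a1, a2, rfl, a3, a4⟩ <;>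
  rcases h1' with ⟨b1, b2, rfl, b3, b4⟩ | ⟨b1, b2, rfl, b3, b4⟩ | ⟨b1, b2, rfl, b3, b4⟩ <;>
  linarith

/-- Even the planar traces of the two loops meet only at the vertex `(36, 6)`, which the open time
intervals exclude. -/
theorem fourCrossingLoop_ne_twoCrossingLoop {s s' : ℝ} (hs : s ∈ Ioo 0 90) (hs' : s' ∈ Ioo 0 72) :
    fourCrossingLoop s ≠ twoCrossingLoop s' := by
  intro h
  obtain ⟨b, x, y, h1, h2, h3⟩ := exists_fourCrossingLoopAt (Ioo_subset_Icc_self hs)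
  obtain ⟨b', x', y', h1', h2', h3'⟩ := exists_twoCrossingLoopAt (Ioo_subset_Icc_self hs')
  rw [h3, h3'] at h
  obtain ⟨ex, ey, eb⟩ := eq_and_eq_of_sheet_hexPoint_eq h2 h2' h
  obtain ⟨p1, p2⟩ := hs
  obtain ⟨p1', p2'⟩ := hs'
  rcases h1 with ⟨a1, a2, rfl, a3, a4⟩ | ⟨a1, a2, rfl, a3, a4⟩ | ⟨a1, a2, rfl, a3, a4⟩ |
    ⟨a1, a2, rfl, a3, a4⟩ | ⟨a1, a2, rfl, a3, a4⟩ <;>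
  rcases h1' with ⟨b1, b2, rfl, b3, b4⟩ | ⟨b1, b2, rfl, b3, b4⟩ | ⟨b1, b2, rfl, b3, b4⟩ <;>
  linarith

theorem fourCrossingLoop_ne_vertex {s : ℝ} (hs : s ∈ Ioo 0 90) :
    fourCrossingLoop s ≠ sheet 6 true (hexPoint 36 6) := by
  intro h
  obtain ⟨b, x, y, h1, h2, h3⟩ := exists_fourCrossingLoopAt (Ioo_subset_Icc_self hs)
  rw [h3] at h
  obtain ⟨ex, ey, -⟩ := eq_and_eq_of_sheet_hexPoint_eq h2 (by norm_num [InHexagon]) h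
  obtain ⟨p1, p2⟩ := hs
  rcases h1 with ⟨a1, a2, -, a3, a4⟩ | ⟨a1, a2, -, a3, a4⟩ | ⟨a1, a2, -, a3, a4⟩ |
    ⟨a1, a2, -, a3, a4⟩ | ⟨a1, a2, -, a3, a4⟩ <;> linarith

theorem twoCrossingLoop_ne_vertex {s : ℝ} (hs : s ∈ Ioo 0 72) :
    twoCrossingLoop s ≠ sheet 6 true (hexPoint 36 6) := by
  intro h
  obtain ⟨b, x, y, h1, h2, h3⟩ := exists_twoCrossingLoopAt (Ioo_subset_Icc_self hs)
  rw [h3] at h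
  obtain ⟨ex, ey, -⟩ := eq_and_eq_of_sheet_hexPoint_eq h2 (by norm_num [InHexagon]) h
  obtain ⟨p1, p2⟩ := hs
  rcases h1 with ⟨a1, a2, -, a3, a4⟩ | ⟨a1, a2, -, a3, a4⟩ | ⟨a1, a2, -, a3, a4⟩ <;> linarith

theorem sheet_hexPoint_notMem_conePoints {x y : ℝ} (b : Bool) (h : InHexagon x y)
    (hne : ∀ k : Fin 6, x = ![54, 27, -27, -54, -27, 27] k →
      y = ![0, 27, 27, 0, -27, -27] k → False) : sheet 6 b (hexPoint x y) ∉ conePoints 6 := by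
  rintro ⟨k, hk⟩
  have hk : frontSheet 6 ⟨polygonVertex 6 k, polygonVertex_mem 6 k⟩ = sheet 6 b (hexPoint x y) := hk
  rw [← sheet_true (polygonVertex_mem 6 k)] at hk
  have := eq_of_sheet_eq (polygonVertex_mem 6 k) (hexPoint_mem_iff.2 h) hk
  rw [polygonVertex_six, hexPoint_inj] at this
  exact hne k this.1.symm this.2.symm

theorem fourCrossingLoop_notMem_conePoints {s : ℝ} (hs : s ∈ Icc 0 90) :
    fourCrossingLoop s ∉ conePoints 6 := by
  obtain ⟨b, x, y, h1, h2, h3⟩ := exists_fourCrossingLoopAt hs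
  rw [h3]
  refine sheet_hexPoint_notMem_conePoints b h2 fun k hx hy => ?_
  rcases h1 with ⟨a1, a2, -, a3, a4⟩ | ⟨a1, a2, -, a3, a4⟩ | ⟨a1, a2, -, a3, a4⟩ |
    ⟨a1, a2, -, a3, a4⟩ | ⟨a1, a2, -, a3, a4⟩ <;>
  fin_cases k <;> simp at hx hy <;> linarith

theorem twoCrossingLoop_notMem_conePoints {s : ℝ} (hs : s ∈ Icc 0 72) :
    twoCrossingLoop s ∉ conePoints 6 := by
  obtain ⟨b, x, y, h1, h2, h3⟩ := exists_twoCrossingLoopAt hs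
  rw [h3]
  refine sheet_hexPoint_notMem_conePoints b h2 fun k hx hy => ?_
  rcases h1 with ⟨a1, a2, -, a3, a4⟩ | ⟨a1, a2, -, a3, a4⟩ | ⟨a1, a2, -, a3, a4⟩ <;>
  fin_cases k <;> simp at hx hy <;> linarith

end Loops

/-! ### Both loops are locally shortest -/

section FigureEight

/-- The piecewise definitions assign a breakpoint to the earlier piece, in the other sheet. It lies
on a side, where the sheets agree, so the later piece may be taken closed. -/
theorem runsStraight_unitSpeed_of_glued {f : ℝ → DoubledPolygon 6} {σ : Bool}
    {a b x y u v : ℝ} (hin : InHexagon x y) (hs : OnHexagonSide x y)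
    (ha : f a = sheet 6 (!σ) (hexPoint x y))
    (h : ∀ s, a < s → s ≤ b → InHexagon (x + (s - a) * u) (y + (s - a) * v) ∧
      f s = sheet 6 σ (hexPoint (x + (s - a) * u) (y + (s - a) * v))) :
    RunsStraight (unitSpeed f) σ (√7 / 54 * a) (√7 / 54 * b) (hexPoint x y)
      (hexDirection u v) := by
  refine runsStraight_unitSpeed fun s hs' => ?_
  rcases hs'.1.eq_or_lt with rfl | hlt
  · simp only [sub_self, zero_mul, add_zero]
    exact ⟨hin, ha.trans (sheet_eq_of_mem_frontier (mem_frontier_of_onHexagonSide hin hs) _ _)⟩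
  · exact h s hlt hs'.2

theorem fourCrossingLoop_runsStraight₁ : RunsStraight (unitSpeed fourCrossingLoop) true
    (√7 / 54 * 0) (√7 / 54 * 12) (hexPoint 36 6) (hexDirection (-1 / 2) (3 / 2)) := by
  refine runsStraight_unitSpeed fun s ⟨h1, h2⟩ => ⟨?_, ?_⟩
  · refine ⟨⟨?_, ?_⟩, ⟨?_, ?_⟩, ?_, ?_⟩ <;> linarith
  · rw [fourCrossingLoop, if_pos h2]

theorem fourCrossingLoop_runsStraight₂ : RunsStraight (unitSpeed fourCrossingLoop) false
    (√7 / 54 * 12) (√7 / 54 * 15) (hexPoint 30 24) (hexDirection (-2) 1) := by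
  refine runsStraight_unitSpeed_of_glued (by norm_num [InHexagon]) (by norm_num [OnHexagonSide])
    (by norm_num [fourCrossingLoop]) fun s h1 h2 => ⟨?_, ?_⟩
  · refine ⟨⟨?_, ?_⟩, ⟨?_, ?_⟩, ?_, ?_⟩ <;> linarith
  · rw [fourCrossingLoop, if_neg (by linarith), if_pos h2]

theorem fourCrossingLoop_runsStraight₃ : RunsStraight (unitSpeed fourCrossingLoop) true
    (√7 / 54 * 15) (√7 / 54 * 50) (hexPoint 24 27) (hexDirection (-2) (-1)) := by
  refine runsStraight_unitSpeed_of_glued (by norm_num [InHexagon]) (by norm_num [OnHexagonSide])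
    (by norm_num [fourCrossingLoop]) fun s h1 h2 => ⟨?_, ?_⟩
  · refine ⟨⟨?_, ?_⟩, ⟨?_, ?_⟩, ?_, ?_⟩ <;> linarith
  · rw [fourCrossingLoop, if_neg (by linarith), if_neg (by linarith), if_pos h2]

theorem fourCrossingLoop_runsStraight₄ : RunsStraight (unitSpeed fourCrossingLoop) false
    (√7 / 54 * 50) (√7 / 54 * 86) (hexPoint (-46) (-8)) (hexDirection (5 / 2) (1 / 2)) := by
  refine runsStraight_unitSpeed_of_glued (by norm_num [InHexagon]) (by norm_num [OnHexagonSide])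
    (by norm_num [fourCrossingLoop]) fun s h1 h2 => ⟨?_, ?_⟩
  · refine ⟨⟨?_, ?_⟩, ⟨?_, ?_⟩, ?_, ?_⟩ <;> linarith
  · rw [fourCrossingLoop, if_neg (by linarith), if_neg (by linarith), if_neg (by linarith),
      if_pos h2]

theorem fourCrossingLoop_runsStraight₅ : RunsStraight (unitSpeed fourCrossingLoop) true
    (√7 / 54 * 86) (√7 / 54 * 90) (hexPoint 44 10) (hexDirection (-2) (-1)) := by
  refine runsStraight_unitSpeed_of_glued (by norm_num [InHexagon]) (by norm_num [OnHexagonSide])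
    (by norm_num [fourCrossingLoop]) fun s h1 h2 => ⟨?_, ?_⟩
  · refine ⟨⟨?_, ?_⟩, ⟨?_, ?_⟩, ?_, ?_⟩ <;> linarith
  · rw [fourCrossingLoop, if_neg (by linarith), if_neg (by linarith), if_neg (by linarith),
      if_neg (by linarith)]

theorem twoCrossingLoop_runsStraight₁ : RunsStraight (unitSpeed twoCrossingLoop) true
    (√7 / 54 * 0) (√7 / 54 * 32) (hexPoint 36 6) (hexDirection (-2) (-1)) := by
  refine runsStraight_unitSpeed fun s ⟨h1, h2⟩ => ⟨?_, ?_⟩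
  · refine ⟨⟨?_, ?_⟩, ⟨?_, ?_⟩, ?_, ?_⟩ <;> linarith
  · rw [twoCrossingLoop, if_pos h2]

theorem twoCrossingLoop_runsStraight₂ : RunsStraight (unitSpeed twoCrossingLoop) false
    (√7 / 54 * 32) (√7 / 54 * 60) (hexPoint (-28) (-26)) (hexDirection (5 / 2) (1 / 2)) := by
  refine runsStraight_unitSpeed_of_glued (by norm_num [InHexagon]) (by norm_num [OnHexagonSide])
    (by norm_num [twoCrossingLoop]) fun s h1 h2 => ⟨?_, ?_⟩
  · refine ⟨⟨?_, ?_⟩, ⟨?_, ?_⟩, ?_, ?_⟩ <;> linarith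
  · rw [twoCrossingLoop, if_neg (by linarith), if_pos h2]

theorem twoCrossingLoop_runsStraight₃ : RunsStraight (unitSpeed twoCrossingLoop) true
    (√7 / 54 * 60) (√7 / 54 * 72) (hexPoint 42 (-12)) (hexDirection (-1 / 2) (3 / 2)) := by
  refine runsStraight_unitSpeed_of_glued (by norm_num [InHexagon]) (by norm_num [OnHexagonSide])
    (by norm_num [twoCrossingLoop]) fun s h1 h2 => ⟨?_, ?_⟩
  · refine ⟨⟨?_, ?_⟩, ⟨?_, ?_⟩, ?_, ?_⟩ <;> linarith
  · rw [twoCrossingLoop, if_neg (by linarith), if_neg (by linarith)]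

/-- Only times near `b` matter, so a bounce checked on its two adjacent pieces serves for a longer
stretch of the loop. -/
theorem IsGeodesicAt.congr_Icc_mul {f : ℝ → DoubledPolygon 6} {a a' e e' b : ℝ}
    (h : IsGeodesicAt f (Icc (√7 / 54 * a') (√7 / 54 * e')) (√7 / 54 * b))
    (h1 : a' < b) (h2 : b < e') :
    IsGeodesicAt f (Icc (√7 / 54 * a) (√7 / 54 * e)) (√7 / 54 * b) := by
  have k1 := mul_lt_mul_of_pos_left h1 (by positivity : 0 < √7 / 54)
  have k2 := mul_lt_mul_of_pos_left h2 (by positivity : 0 < √7 / 54)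
  refine h.congr_set (lt_min (sub_pos.2 k1) (sub_pos.2 k2)) fun s _ hd => ?_
  rw [Real.dist_eq, lt_min_iff, abs_lt, abs_lt] at hd
  constructor <;> linarith [hd.1.1, hd.2.2]

theorem isUnitSpeedGeodesic_fourCrossingLoop :
    IsUnitSpeedGeodesic (unitSpeed fourCrossingLoop) (√7 / 54 * 90) := by
  have n₁ : (-1 / 2 : ℝ) ^ 2 + 3 * (3 / 2) ^ 2 = 7 := by norm_num
  have n₂ : (-2 : ℝ) ^ 2 + 3 * 1 ^ 2 = 7 := by norm_num
  have n₃ : (-2 : ℝ) ^ 2 + 3 * (-1) ^ 2 = 7 := by norm_num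
  have n₄ : (5 / 2 : ℝ) ^ 2 + 3 * (1 / 2) ^ 2 = 7 := by norm_num
  have g₁ := fun t (_ : t ∈ Icc (√7 / 54 * 0) (√7 / 54 * 12)) =>
    fourCrossingLoop_runsStraight₁.isGeodesicAt (norm_hexDirection n₁) t
  have g₂ := fun t (_ : t ∈ Icc (√7 / 54 * 12) (√7 / 54 * 15)) =>
    fourCrossingLoop_runsStraight₂.isGeodesicAt (norm_hexDirection n₂) t
  have g₃ := fun t (_ : t ∈ Icc (√7 / 54 * 15) (√7 / 54 * 50)) =>
    fourCrossingLoop_runsStraight₃.isGeodesicAt (norm_hexDirection n₃) t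
  have g₄ := fun t (_ : t ∈ Icc (√7 / 54 * 50) (√7 / 54 * 86)) =>
    fourCrossingLoop_runsStraight₄.isGeodesicAt (norm_hexDirection n₄) t
  have g₅ := fun t (_ : t ∈ Icc (√7 / 54 * 86) (√7 / 54 * 90)) =>
    fourCrossingLoop_runsStraight₅.isGeodesicAt (norm_hexDirection n₃) t
  have b₁ := isGeodesicAt_unitSpeed fourCrossingLoop_runsStraight₁ fourCrossingLoop_runsStraight₂
    (by norm_num) (by norm_num) (by norm_num [InHexagon]) (by norm_num [OnHexagonSide]) n₁ n₂
    (by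
      intro p q h hp hq
      rw [abs_lt] at hp hq
      rcases h with h | h | h | h | h | h <;> linarith)
  have b₂ := isGeodesicAt_unitSpeed fourCrossingLoop_runsStraight₂ fourCrossingLoop_runsStraight₃
    (by norm_num) (by norm_num) (by norm_num [InHexagon]) (by norm_num [OnHexagonSide]) n₂ n₃
    (by
      intro p q h hp hq
      rw [abs_lt] at hp hq
      rcases h with h | h | h | h | h | h <;> linarith)
  have b₃ := isGeodesicAt_unitSpeed fourCrossingLoop_runsStraight₃ fourCrossingLoop_runsStraight₄
    (by norm_num) (by norm_num) (by norm_num [InHexagon]) (by norm_num [OnHexagonSide]) n₃ n₄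
    (by
      intro p q h hp hq
      rw [abs_lt] at hp hq
      rcases h with h | h | h | h | h | h <;> linarith)
  have b₄ := isGeodesicAt_unitSpeed fourCrossingLoop_runsStraight₄ fourCrossingLoop_runsStraight₅
    (by norm_num) (by norm_num) (by norm_num [InHexagon]) (by norm_num [OnHexagonSide]) n₄ n₃
    (by
      intro p q h hp hq
      rw [abs_lt] at hp hq
      rcases h with h | h | h | h | h | h <;> linarith)
  have := isGeodesicAt_Icc_append g₁ (isGeodesicAt_Icc_append g₂ (isGeodesicAt_Icc_append g₃
    (isGeodesicAt_Icc_append g₄ g₅ b₄) (b₃.congr_Icc_mul (by norm_num) (by norm_num)))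
    (b₂.congr_Icc_mul (by norm_num) (by norm_num))) (b₁.congr_Icc_mul (by norm_num) (by norm_num))
  rw [mul_zero] at this
  exact this

theorem isUnitSpeedGeodesic_twoCrossingLoop :
    IsUnitSpeedGeodesic (unitSpeed twoCrossingLoop) (√7 / 54 * 72) := by
  have n₁ : (-2 : ℝ) ^ 2 + 3 * (-1) ^ 2 = 7 := by norm_num
  have n₂ : (5 / 2 : ℝ) ^ 2 + 3 * (1 / 2) ^ 2 = 7 := by norm_num
  have n₃ : (-1 / 2 : ℝ) ^ 2 + 3 * (3 / 2) ^ 2 = 7 := by norm_num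
  have g₁ := fun t (_ : t ∈ Icc (√7 / 54 * 0) (√7 / 54 * 32)) =>
    twoCrossingLoop_runsStraight₁.isGeodesicAt (norm_hexDirection n₁) t
  have g₂ := fun t (_ : t ∈ Icc (√7 / 54 * 32) (√7 / 54 * 60)) =>
    twoCrossingLoop_runsStraight₂.isGeodesicAt (norm_hexDirection n₂) t
  have g₃ := fun t (_ : t ∈ Icc (√7 / 54 * 60) (√7 / 54 * 72)) =>
    twoCrossingLoop_runsStraight₃.isGeodesicAt (norm_hexDirection n₃) t
  have b₁ := isGeodesicAt_unitSpeed twoCrossingLoop_runsStraight₁ twoCrossingLoop_runsStraight₂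
    (by norm_num) (by norm_num) (by norm_num [InHexagon]) (by norm_num [OnHexagonSide]) n₁ n₂
    (by
      intro p q h hp hq
      rw [abs_lt] at hp hq
      rcases h with h | h | h | h | h | h <;> linarith)
  have b₂ := isGeodesicAt_unitSpeed twoCrossingLoop_runsStraight₂ twoCrossingLoop_runsStraight₃
    (by norm_num) (by norm_num) (by norm_num [InHexagon]) (by norm_num [OnHexagonSide]) n₂ n₃
    (by
      intro p q h hp hq
      rw [abs_lt] at hp hq
      rcases h with h | h | h | h | h | h <;> linarith)
  have := isGeodesicAt_Icc_append g₁ (isGeodesicAt_Icc_append g₂ g₃ b₂)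
    (b₁.congr_Icc_mul (by norm_num) (by norm_num))
  rw [mul_zero] at this
  exact this

/-! ### Tangent vectors at the vertex and assembly of the net -/

theorem RunsStraight.hasDerivWithinAt_start {n : ℕ} [NeZero n] {γ : ℝ → DoubledPolygon n}
    {σ : Bool} {b : ℝ} {c d : ℂ} (h : RunsStraight γ σ 0 b c d) (hb : 0 < b) :
    HasDerivWithinAt
      (fun t => Function.invFunOn (sheet n σ) (regularPolygon n) (γ t)) d (Ici 0) 0 := by
  have hlin : HasDerivWithinAt (fun t : ℝ => c + ((t - 0 : ℝ) : ℂ) * d) d (Ici 0) 0 := by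
    have := (((hasDerivAt_id (0 : ℝ)).sub_const 0).ofReal_comp.mul_const d).const_add c
    simpa using this.hasDerivWithinAt
  have hev : ∀ t ∈ Icc 0 b, Function.invFunOn (sheet n σ) (regularPolygon n) (γ t) =
      c + ((t - 0 : ℝ) : ℂ) * d := fun t ht => by
    rw [(h t ht).2, invFunOn_sheet σ (h t ht).1]
  refine hlin.congr_of_eventuallyEq ?_ (hev 0 (left_mem_Icc.2 hb.le))
  filter_upwards [Icc_mem_nhdsGE hb] with t ht using hev t ht

/-- Reduces the tangent vector at the end of a loop to the one at the start of a reversed piece. -/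
theorem RunsStraight.reverse {n : ℕ} [NeZero n] {γ : ℝ → DoubledPolygon n} {σ : Bool}
    {a b : ℝ} {c d c' : ℂ} (h : RunsStraight γ σ a b c d) (hc' : c + ((b - a : ℝ) : ℂ) * d = c') :
    RunsStraight (fun t => γ (b - t)) σ 0 (b - a) c' (-d) := by
  intro t ht
  have e : c' + ((t - 0 : ℝ) : ℂ) * -d = c + ((b - t - a : ℝ) : ℂ) * d := by
    rw [← hc']; push_cast; ring
  rw [e]
  exact h (b - t) ⟨by linarith [ht.2], by linarith [ht.1]⟩

theorem ball_hexPoint_subset_interior :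
    ball (hexPoint 36 6) (1 / 54) ⊆ interior (regularPolygon 6) := by
  refine interior_maximal (fun z hz => ?_) isOpen_ball
  obtain ⟨x, y, rfl⟩ := exists_eq_hexPoint z
  obtain ⟨h1, h2⟩ := abs_sub_lt_of_dist_hexPoint_lt one_pos hz
  have h3 : |y - 6| < 1 := by
    have : 1 ≤ √3 := Real.one_le_sqrt.2 (by norm_num)
    nlinarith [abs_nonneg (y - 6)]
  rw [abs_lt] at h1 h3
  refine hexPoint_mem_iff.2 ⟨⟨?_, ?_⟩, ⟨?_, ?_⟩, ?_, ?_⟩ <;> linarith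

/-- The figure-eight graph on the doubled regular hexagon. -/
noncomputable def hexagonFigureEight :
    GeodesicNet figureEight (DoubledPolygon 6) (conePoints 6) where
  vertex _ := sheet 6 true (hexPoint 36 6)
  length := ![√7 / 54 * 90, √7 / 54 * 72]
  edge := ![unitSpeed fourCrossingLoop, unitSpeed twoCrossingLoop]
  length_pos := Fin.forall_fin_two.2 ⟨by simp, by simp⟩
  edge_zero := Fin.forall_fin_two.2
    ⟨by norm_num [unitSpeed, fourCrossingLoop], by norm_num [unitSpeed, twoCrossingLoop]⟩
  edge_length := Fin.forall_fin_two.2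
    ⟨(unitSpeed_apply_mul fourCrossingLoop 90).trans (by norm_num [fourCrossingLoop]),
      (unitSpeed_apply_mul twoCrossingLoop 72).trans (by norm_num [twoCrossingLoop])⟩
  vertex_regular _ := sheet_hexPoint_notMem_conePoints _ (by norm_num [InHexagon]) fun k hx => by
    fin_cases k <;> norm_num at hx
  edge_regular := Fin.forall_fin_two.2
    ⟨fun t ht => fourCrossingLoop_notMem_conePoints
        (mem_Icc_of_mem_Icc_mul (by rw [mul_zero]; exact ht)),
      fun t ht => twoCrossingLoop_notMem_conePoints
        (mem_Icc_of_mem_Icc_mul (by rw [mul_zero]; exact ht))⟩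
  vertex_injective _ _ _ := rfl
  edge_ne_vertex := Fin.forall_fin_two.2
    ⟨fun t ht _ => fourCrossingLoop_ne_vertex (mem_Ioo_of_mem_Ioo_mul ht),
      fun t ht _ => twoCrossingLoop_ne_vertex (mem_Ioo_of_mem_Ioo_mul ht)⟩
  edge_injective := by
    have inj : ∀ {t t' : ℝ}, 54 / √7 * t = 54 / √7 * t' → t = t' :=
      fun h => mul_left_cancel₀ (by positivity) h
    refine Fin.forall_fin_two.2 ⟨fun t ht => Fin.forall_fin_two.2 ⟨fun t' ht' h => ?_,
      fun t' ht' h => ?_⟩, fun t ht => Fin.forall_fin_two.2 ⟨fun t' ht' h => ?_,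
      fun t' ht' h => ?_⟩⟩
    · exact ⟨rfl, inj (fourCrossingLoop_injOn (mem_Ioo_of_mem_Ioo_mul ht)
        (mem_Ioo_of_mem_Ioo_mul ht') h)⟩
    · exact absurd h (fourCrossingLoop_ne_twoCrossingLoop (mem_Ioo_of_mem_Ioo_mul ht)
        (mem_Ioo_of_mem_Ioo_mul ht'))
    · exact absurd h.symm (fourCrossingLoop_ne_twoCrossingLoop (mem_Ioo_of_mem_Ioo_mul ht')
        (mem_Ioo_of_mem_Ioo_mul ht))
    · exact ⟨rfl, inj (twoCrossingLoop_injOn (mem_Ioo_of_mem_Ioo_mul ht)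
        (mem_Ioo_of_mem_Ioo_mul ht') h)⟩
  edge_geodesic := Fin.forall_fin_two.2
    ⟨isUnitSpeedGeodesic_fourCrossingLoop, isUnitSpeedGeodesic_twoCrossingLoop⟩
  chart _ := sheetChart true (by norm_num) ball_hexPoint_subset_interior
  -- Each loop departs along the arrival velocity of the other, so `endDir` is `startDir` swapped
  -- and negated, and the sum vanishes.
  startDir := ![hexDirection (-1 / 2) (3 / 2), hexDirection (-2) (-1)]
  endDir := ![-hexDirection (-2) (-1), -hexDirection (-1 / 2) (3 / 2)]
  hasDeriv_start := by
    have h₁ := fourCrossingLoop_runsStraight₁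
    have h₂ := twoCrossingLoop_runsStraight₁
    rw [mul_zero] at h₁ h₂
    exact Fin.forall_fin_two.2 ⟨h₁.hasDerivWithinAt_start (by positivity),
      h₂.hasDerivWithinAt_start (by positivity)⟩
  hasDeriv_end := by
    have h₁ := fourCrossingLoop_runsStraight₅.reverse (c' := hexPoint 36 6) (by
      rw [hexPoint_add_mul_hexDirection, hexPoint_inj]
      constructor <;> field_simp <;> norm_num)
    have h₂ := twoCrossingLoop_runsStraight₃.reverse (c' := hexPoint 36 6) (by
      rw [hexPoint_add_mul_hexDirection, hexPoint_inj]
      constructor <;> field_simp <;> norm_num)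
    rw [← mul_sub] at h₁ h₂
    exact Fin.forall_fin_two.2 ⟨h₁.hasDerivWithinAt_start (by norm_num),
      h₂.hasDerivWithinAt_start (by norm_num)⟩
  balanced _ := by
    simp [Fin.sum_univ_two]

/-- The inner product of these unit vectors is `(1 - 9/2) / 7 = -1/2`. -/
theorem angle_hexDirection_eq :
    InnerProductGeometry.angle (hexDirection (-2) (-1)) (hexDirection (-1 / 2) (3 / 2)) =
      2 * Real.pi / 3 := by
  have hcos : Real.cos (2 * Real.pi / 3) = -1 / 2 := by
    rw [show 2 * Real.pi / 3 = Real.pi - Real.pi / 3 by ring, Real.cos_pi_sub,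
      Real.cos_pi_div_three]
    norm_num
  rw [InnerProductGeometry.angle, inner_hexDirection, norm_hexDirection (by norm_num),
    norm_hexDirection (by norm_num)]
  rw [show ((-2 : ℝ) * (-1 / 2) + 3 * -1 * (3 / 2)) / 7 / (1 * 1) = Real.cos (2 * Real.pi / 3) by
    rw [hcos]; norm_num]
  exact Real.arccos_cos (by positivity) (by linarith [Real.pi_pos])

end FigureEight

theorem mainTheorem9 :
    ∃ N : GeodesicNet figureEight (DoubledPolygon 6) (conePoints 6),
      ∀ e, N.turningAngle e = 2 * Real.pi / 3 := by
  refine ⟨hexagonFigureEight, Fin.forall_fin_two.2 ⟨?_, ?_⟩⟩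
  · simp [GeodesicNet.turningAngle, hexagonFigureEight, angle_hexDirection_eq]
  -- The second loop has the same two velocities with arrival and departure exchanged.
  · rw [← angle_hexDirection_eq, InnerProductGeometry.angle_comm]
    simp [GeodesicNet.turningAngle, hexagonFigureEight]
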